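/- For a group $G$, a positive cone of $G$ is a subset $P\subseteq G$ with $P\cdot P\subseteq P$ and $G=P\sqcup P^{-1}\sqcup\{1\}$ (disjoint union). Let $\mathrm{LO}(G)$ be the set of all positive cones of $G$ (equivalently, of all left-orderings of $G$), with the Borel structure of its topology as a subspace of the product space $2^G$; for countable $G$ it is a standard Borel space. Let $E_{\mathrm{lo}}(G)$ be the orbit equivalence relation of the conjugation action of $G$ on $\mathrm{LO}(G)$: $(P,Q)\in E_{\mathrm{lo}}(G)$ if and only if $Q=gPg^{-1}$ for some $g\in G$. For equivalence relations $E$ and $F$ on standard Borel spaces $X$ and $Y$, write $E\leq_B F$ if there is a Borel map $f\colon X\to Y$ such that $x_0\mathrel{E}x_1\iff f(x_0)\mathrel{F}f(x_1)$ for all $x_0,x_1\in X$. Let $\mathbb{F}_2$ be the free group on two generators and $\mathbb{F}_\infty$ the free group on countably infinitely many generators. **Proposition.** $E_{\mathrm{lo}}(\mathbb{F}_\infty)\leq_B E_{\mathrm{lo}}(\mathbb{F}_2)$. -/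

import Mathlib

open scoped Pointwise

/-- `P` is a positive cone of the group `G`: `P * P ⊆ P`, and `G` is the disjoint union of
`P`, `P⁻¹` and `{1}`. -/
structure IsPositiveCone {G : Type*} [Group G] (P : Set G) : Prop where
  mul_subset : P * P ⊆ P
  union_eq : P ∪ P⁻¹ ∪ {1} = Set.univ
  disjoint_inv : Disjoint P P⁻¹
  one_notMem : (1 : G) ∉ P

/-- The space `LO(G)` of left-orderings of `G`, each left-ordering being identified with its
positive cone `{g | 1 < g}`. -/
def LO (G : Type*) [Group G] : Type _ := {P : Set G // IsPositiveCone P}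

namespace LO

variable {G : Type*} [Group G]

/-- The positive cone of a left-ordering. -/
def cone (P : LO G) : Set G := P.1

theorem cone_injective : Function.Injective (cone : LO G → Set G) := Subtype.val_injective

open Classical in
/-- The inclusion of `LO(G)` in `2^G`. -/
noncomputable def indicator (P : LO G) : G → Bool := fun g => decide (g ∈ P.cone)

theorem isPositiveCone (P : LO G) : IsPositiveCone P.cone := P.2

theorem indicator_eq_true (P : LO G) (g : G) : P.indicator g = true ↔ g ∈ P.cone := by
  simp [indicator]

/-- `LO(G)` carries the subspace topology of the product space `2^G`
(where `2 = Bool` is discrete). -/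
noncomputable instance : TopologicalSpace (LO G) := TopologicalSpace.induced indicator inferInstance

/-- `LO(G)` carries the Borel σ-algebra of its topology. -/
noncomputable instance : MeasurableSpace (LO G) := borel (LO G)

instance : BorelSpace (LO G) := ⟨rfl⟩

theorem mem_range_indicator (x : G → Bool) :
    x ∈ Set.range (indicator : LO G → G → Bool) ↔
      ((∀ g h, x g = true → x h = true → x (g * h) = true) ∧
        (∀ g, g ≠ 1 → (x g = true ∨ x g⁻¹ = true)) ∧
        (∀ g, ¬ (x g = true ∧ x g⁻¹ = true)) ∧ x 1 = false) := by
  constructor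
  · rintro ⟨P, rfl⟩
    have h := P.isPositiveCone
    refine ⟨fun g k hg hk => ?_, fun g hg => ?_, fun g => ?_, ?_⟩
    · simp only [indicator_eq_true] at *
      exact h.mul_subset (Set.mul_mem_mul hg hk)
    · have := h.union_eq.symm.subset (Set.mem_univ g)
      simpa [indicator_eq_true, hg] using this
    · rintro ⟨h1, h2⟩
      rw [indicator_eq_true] at h1 h2
      exact Set.disjoint_left.1 h.disjoint_inv h1 (by simpa using h2)
    · rw [← Bool.not_eq_true, indicator_eq_true]
      exact h.one_notMem
  · rintro ⟨h1, h2, h3, h4⟩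
    refine ⟨⟨{g | x g = true}, ⟨?_, ?_, ?_, ?_⟩⟩, ?_⟩
    · rintro _ ⟨g, hg, k, hk, rfl⟩
      exact h1 g k hg hk
    · ext g
      by_cases hg : g = 1
      · simp [hg]
      · simpa [hg] using h2 g hg
    · rw [Set.disjoint_left]
      intro g hg hg'
      exact h3 g ⟨hg, by simpa using hg'⟩
    · simp [h4]
    · funext g
      exact Bool.eq_iff_iff.2 (indicator_eq_true _ g)

theorem isClosedEmbedding_indicator :
    Topology.IsClosedEmbedding (indicator : LO G → G → Bool) := by
  refine ⟨⟨⟨rfl⟩, ?_⟩, ?_⟩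
  · intro P Q h
    apply cone_injective
    ext g
    rw [← indicator_eq_true, ← indicator_eq_true, h]
  · have hc : ∀ g : G, ∀ b : Bool, IsClopen {x : G → Bool | x g = b} := fun g b =>
      (isClopen_discrete {b}).preimage (continuous_apply g)
    have : Set.range (indicator : LO G → G → Bool) =
        (⋂ g, ⋂ h, ({x | x g = true}ᶜ ∪ ({x | x h = true}ᶜ ∪ {x | x (g * h) = true}))) ∩
        ((⋂ g, ⋂ (_ : g ≠ 1), ({x | x g = true} ∪ {x | x g⁻¹ = true})) ∩
        ((⋂ g, ({x | x g = true} ∩ {x | x g⁻¹ = true})ᶜ) ∩ {x | x 1 = false})) := by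
      ext x
      rw [mem_range_indicator]
      simp only [Set.mem_inter_iff, Set.mem_iInter, Set.mem_union, Set.mem_compl_iff,
        Set.mem_ofPred_eq, imp_iff_not_or]
    rw [this]
    refine IsClosed.inter ?_ (IsClosed.inter ?_ (IsClosed.inter ?_ (hc _ _).isClosed))
    · exact isClosed_iInter fun g => isClosed_iInter fun h =>
        ((hc _ _).compl.union ((hc _ _).compl.union (hc _ _))).isClosed
    · exact isClosed_iInter fun g => isClosed_iInter fun _ => ((hc _ _).union (hc _ _)).isClosed
    · exact isClosed_iInter fun g => ((hc _ _).inter (hc _ _)).compl.isClosed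

/-- For a countable group, `LO(G)` is a Polish space. -/
instance [Countable G] : PolishSpace (LO G) := 
  letI : UniformSpace Bool := ⊥
  haveI : DiscreteUniformity Bool := ⟨rfl⟩
  haveI : (uniformity Bool).IsCountablyGenerated :=
    Filter.isCountablyGenerated_principal _
  haveI : TopologicalSpace.IsCompletelyMetrizableSpace (G → Bool) :=
    TopologicalSpace.IsCompletelyMetrizableSpace.of_completeSpace_metrizable
  haveI : PolishSpace (G → Bool) := inferInstance
  isClosedEmbedding_indicator.polishSpace

/-- The conjugation action: the image of the left-ordering with positive cone `P` under `g` is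
the left-ordering with positive cone `g P g⁻¹`. -/
instance : MulAction G (LO G) where
  smul g P := ⟨(fun x => g * x * g⁻¹) '' P.cone, by
    have hP := P.isPositiveCone
    have key : ∀ y : G, y ∈ (fun x => g * x * g⁻¹) '' P.cone ↔ g⁻¹ * y * g ∈ P.cone := fun y =>
      ⟨by rintro ⟨x, hx, rfl⟩; simpa [mul_assoc] using hx,
        fun h => ⟨g⁻¹ * y * g, h, by simp [mul_assoc]⟩⟩
    refine ⟨?_, ?_, ?_, ?_⟩
    · rintro _ ⟨y, hy, z, hz, rfl⟩
      rw [key] at hy hz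
      rw [key]
      have := hP.mul_subset (Set.mul_mem_mul hy hz)
      simpa [mul_assoc] using this
    · ext y
      have := hP.union_eq.symm.subset (Set.mem_univ (g⁻¹ * y * g))
      simp only [Set.mem_union, Set.mem_inv, key, Set.mem_singleton_iff, Set.mem_univ,
        iff_true] at this ⊢
      rcases this with (h | h) | h
      · exact Or.inl (Or.inl h)
      · exact Or.inl (Or.inr (by simpa [mul_assoc] using h))
      · refine Or.inr ?_
        calc y = g * (g⁻¹ * y * g) * g⁻¹ := by simp [mul_assoc]
          _ = 1 := by rw [h]; simp
    · rw [Set.disjoint_left]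
      intro y hy hy'
      rw [Set.mem_inv, key] at hy'
      rw [key] at hy
      exact Set.disjoint_left.1 hP.disjoint_inv hy (by simpa [mul_assoc] using hy')
    · rw [key]
      simpa using hP.one_notMem⟩
  one_smul P := by
    apply cone_injective
    change (fun x => (1 : G) * x * (1 : G)⁻¹) '' P.cone = P.cone
    simp
  mul_smul g h P := by
    apply cone_injective
    change (fun x => g * h * x * (g * h)⁻¹) '' P.cone =
      (fun x => g * x * g⁻¹) '' ((fun x => h * x * h⁻¹) '' P.cone)
    rw [Set.image_image]
    simp [mul_assoc]

theorem cone_smul (g : G) (P : LO G) : (g • P).cone = (fun x => g * x * g⁻¹) '' P.cone := rfl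

end LO

/-- The equivalence relation `E_lo(G)` on `LO(G)` whose classes are the orbits of the
conjugation action. -/
def Elo (G : Type*) [Group G] : Setoid (LO G) := MulAction.orbitRel G (LO G)

theorem Elo_iff {G : Type*} [Group G] (P Q : LO G) :
    Elo G P Q ↔ ∃ g : G, Q.cone = (fun x => g * x * g⁻¹) '' P.cone := by
  rw [Setoid.comm']
  refine MulAction.orbitRel_apply.trans (exists_congr fun g => ?_)
  exact ⟨fun h => h ▸ rfl, fun h => LO.cone_injective h.symm⟩

/-- Borel reducibility `E ≤_B F` of equivalence relations on standard Borel spaces. -/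
def BorelReducible {X Y : Type*} [MeasurableSpace X] [StandardBorelSpace X]
    [MeasurableSpace Y] [StandardBorelSpace Y] (E : Setoid X) (F : Setoid Y) : Prop :=
  ∃ f : X → Y, Measurable f ∧ ∀ x₀ x₁ : X, E x₀ x₁ ↔ F (f x₀) (f x₁)

/-! Suppose a subgroup `A` of `G` has a left-invariant order on its cosets. Every left-ordering of
`A` then extends lexicographically to `G` with `A` convex, and the extension depends continuously on
the ordering. Conjugating by elements of `A` respects the extension, since the coset part is
invariant under `A`. Conversely, if `g` carries one extended order to another, then `A` and its
conjugate by `g` are convex for the same order, hence comparable by inclusion. If only elements of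
`A` conjugate `A` into itself, then `g ∈ A` and the original orders were already conjugate in `A`
(`IsCosetCone.borelReducible`).

It remains to find such a copy of the free group of infinite rank in the free group on two
generators. The latter is the semidirect product of the free group on `ℤ` by the shift. The whole
normal factor is useless, being normal; instead `A` is generated by the basis elements of nonzero
index. For the coset order, each element outside `A` is detected by an action on the line in which
`A` fixes `0` (`FreeGroup.exists_action`); countably many actions combine lexicographically, and the
`ℤ` quotient is put on top. Self-conjugation is controlled by the exponent sum of the omitted
generator and by the retraction onto the free factor (`semidirectProduct_shiftHom_self_conj`). -/

theorem mem_image_conj {G : Type*} [Group G] (g y : G) (P : Set G) :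
    y ∈ (fun x => g * x * g⁻¹) '' P ↔ g⁻¹ * y * g ∈ P :=
  ⟨by rintro ⟨x, hx, rfl⟩; simpa [mul_assoc] using hx,
    fun h => ⟨g⁻¹ * y * g, h, by simp [mul_assoc]⟩⟩

/-! ### Coset orders and lexicographic extension -/

/-- `C` is the set of elements `g` with `H < gH` for some left-invariant linear order on the set of
left cosets of `H` in `G`. -/
structure IsCosetCone {G : Type*} [Group G] (H : Subgroup G) (C : Set G) : Prop where
  mul_mem : ∀ {x y}, x ∈ C → y ∈ C → x * y ∈ C
  subgroup_mul_mem : ∀ {h x}, h ∈ H → x ∈ C → h * x ∈ C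
  mul_subgroup_mem : ∀ {x h}, x ∈ C → h ∈ H → x * h ∈ C
  notMem_subgroup : ∀ {x}, x ∈ C → x ∉ H
  trichotomy : ∀ x, x ∈ H ∨ x ∈ C ∨ x⁻¹ ∈ C

namespace IsCosetCone

variable {A G G' : Type*} [Group A] [Group G] [Group G'] {H : Subgroup G} {C : Set G}

theorem inv_notMem (hC : IsCosetCone H C) {x : G} (hx : x ∈ C) : x⁻¹ ∉ C := fun hx' =>
  hC.notMem_subgroup (hC.mul_mem hx hx') (by simp [H.one_mem])

theorem comap (hC : IsCosetCone H C) (f : G' →* G) : IsCosetCone (H.comap f) (f ⁻¹' C) where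
  mul_mem hx hy := by simpa using hC.mul_mem hx hy
  subgroup_mul_mem hx hy := by simpa using hC.subgroup_mul_mem hx hy
  mul_subgroup_mem hx hy := by simpa using hC.mul_subgroup_mem hx hy
  notMem_subgroup hx := hC.notMem_subgroup hx
  trichotomy x := by simpa using hC.trichotomy (f x)

/-- The lexicographic extension of a left-ordering of the subgroup `ι(A)` by a left-invariant
order on its cosets. -/
def extend {ι : A →* G} (hι : Function.Injective ι) (hC : IsCosetCone ι.range C) (P : LO A) :
    LO G := ⟨ι '' P.cone ∪ C, by
  have hP := P.isPositiveCone
  have hr : ∀ a, ι a ∈ ι.range := fun a => ⟨a, rfl⟩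
  refine ⟨?_, ?_, ?_, ?_⟩
  · rintro _ ⟨_, ⟨a, ha, rfl⟩ | hx, _, ⟨b, hb, rfl⟩ | hy, rfl⟩
    · exact Or.inl ⟨a * b, hP.mul_subset (Set.mul_mem_mul ha hb), map_mul ι a b⟩
    · exact Or.inr (hC.subgroup_mul_mem (hr a) hy)
    · exact Or.inr (hC.mul_subgroup_mem hx (hr b))
    · exact Or.inr (hC.mul_mem hx hy)
  · refine Set.eq_univ_of_forall fun x => ?_
    rcases hC.trichotomy x with ⟨a, rfl⟩ | h | h
    · rcases hP.union_eq.symm.subset (Set.mem_univ a) with (h | h) | h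
      · exact Or.inl (Or.inl (Or.inl ⟨a, h, rfl⟩))
      · exact Or.inl (Or.inr (Or.inl ⟨a⁻¹, h, map_inv ι a⟩))
      · exact Or.inr (by simpa using congrArg ι h)
    · exact Or.inl (Or.inl (Or.inr h))
    · exact Or.inl (Or.inr (Or.inr h))
  · rw [Set.disjoint_left]
    rintro _ (⟨a, ha, rfl⟩ | hx) (⟨b, hb, hab⟩ | hy)
    · rw [← map_inv] at hab
      rw [hι hab] at hb
      exact Set.disjoint_left.1 hP.disjoint_inv ha hb
    · exact hC.notMem_subgroup hy (inv_mem (hr a))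
    · exact hC.notMem_subgroup hx (inv_mem_iff.1 (hab ▸ hr b))
    · exact hC.inv_notMem hx hy
  · rintro (⟨a, ha, h⟩ | h)
    · rw [hι (h.trans (map_one ι).symm)] at ha
      exact hP.one_notMem ha
    · exact hC.notMem_subgroup h (one_mem _)⟩

theorem cone_extend {ι : A →* G} (hι : Function.Injective ι) (hC : IsCosetCone ι.range C)
    (P : LO A) : (hC.extend hι P).cone = ι '' P.cone ∪ C := rfl

theorem apply_mem_cone_extend {ι : A →* G} (hι : Function.Injective ι)
    (hC : IsCosetCone ι.range C) (P : LO A) (a : A) :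
    ι a ∈ (hC.extend hι P).cone ↔ a ∈ P.cone := by
  rw [cone_extend]
  refine ⟨?_, fun h => Or.inl ⟨a, h, rfl⟩⟩
  rintro (⟨b, hb, h⟩ | h)
  · rwa [← hι h]
  · exact absurd ⟨a, rfl⟩ (hC.notMem_subgroup h)

theorem mem_cone_extend_of_notMem {ι : A →* G} (hι : Function.Injective ι)
    (hC : IsCosetCone ι.range C) (P : LO A) {x : G} (hx : x ∉ ι.range) :
    x ∈ (hC.extend hι P).cone ↔ x ∈ C := by
  rw [cone_extend]
  refine ⟨?_, Or.inr⟩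
  rintro (⟨b, hb, rfl⟩ | h)
  · exact absurd ⟨b, rfl⟩ hx
  · exact h

theorem continuous_extend {ι : A →* G} (hι : Function.Injective ι)
    (hC : IsCosetCone ι.range C) : Continuous (hC.extend hι) := by
  refine continuous_induced_rng.2 (continuous_pi fun x => ?_)
  by_cases hx : x ∈ ι.range
  · obtain ⟨a, rfl⟩ := hx
    have : (fun P : LO A => (LO.indicator ∘ hC.extend hι) P (ι a)) = fun P => P.indicator a := by
      funext P
      rw [Bool.eq_iff_iff, Function.comp_apply, LO.indicator_eq_true, LO.indicator_eq_true,
        apply_mem_cone_extend]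
    rw [this]
    exact (continuous_apply a).comp LO.isClosedEmbedding_indicator.continuous
  · classical
    have : (fun P : LO A => (LO.indicator ∘ hC.extend hι) P x) = fun _ => decide (x ∈ C) := by
      funext P
      rw [Bool.eq_iff_iff, Function.comp_apply, LO.indicator_eq_true,
        mem_cone_extend_of_notMem _ _ _ hx, decide_eq_true_iff]
    rw [this]
    exact continuous_const

theorem conj_mem (hC : IsCosetCone H C) {h x : G} (hh : h ∈ H) : h⁻¹ * x * h ∈ C ↔ x ∈ C := by
  refine ⟨fun hx => ?_, fun hx => hC.mul_subgroup_mem (hC.subgroup_mul_mem (inv_mem hh) hx) hh⟩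
  simpa [mul_assoc] using
    hC.mul_subgroup_mem (hC.subgroup_mul_mem hh hx) (inv_mem hh)

/-- Convex subgroups of a left-ordered group are comparable, for a convex subgroup and its
conjugate. -/
theorem conj_le_or_le_conj (hC : IsCosetCone H C) {R : Set G} (hR : IsPositiveCone R)
    (hCR : C ⊆ R) {g : G} (hgCR : ∀ x, g⁻¹ * x * g ∈ C → x ∈ R) :
    (∀ h ∈ H, g⁻¹ * h * g ∈ H) ∨ (∀ h ∈ H, g * h * g⁻¹ ∈ H) := by
  by_contra! hcon
  obtain ⟨⟨h, hh, hhg⟩, u, hu, hug⟩ := hcon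
  -- The element `h⁻¹ * (g * u * g⁻¹)` is positive because it lies in `C`, while its inverse is
  -- positive because its conjugate `u⁻¹ * (g⁻¹ * h * g)` lies in `C`. Replacing `h` and `u` by
  -- inverses reduces every case to this one.
  have key : ∀ h ∈ H, ∀ u ∈ H, g⁻¹ * h * g ∈ C → g * u * g⁻¹ ∈ C → False := by
    intro h hh u hu h1 h2
    refine Set.disjoint_left.1 hR.disjoint_inv (hCR (hC.subgroup_mul_mem (inv_mem hh) h2))
      (hgCR _ ?_)
    have := hC.subgroup_mul_mem (inv_mem hu) h1
    simpa [mul_assoc] using this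
  have inv1 : (g⁻¹ * h * g)⁻¹ = g⁻¹ * h⁻¹ * g := by simp [mul_assoc]
  have inv2 : (g * u * g⁻¹)⁻¹ = g * u⁻¹ * g⁻¹ := by simp [mul_assoc]
  rcases hC.trichotomy (g⁻¹ * h * g) with h1 | h1 | h1
  · exact hhg h1
  all_goals
    rcases (hC.trichotomy (g * u * g⁻¹)).resolve_left hug with h2 | h2
  · exact key h hh u hu h1 h2
  · exact key h hh u⁻¹ (inv_mem hu) h1 (inv2 ▸ h2)
  · exact key h⁻¹ (inv_mem hh) u hu (inv1 ▸ h1) h2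
  · exact key h⁻¹ (inv_mem hh) u⁻¹ (inv_mem hu) (inv1 ▸ h1) (inv2 ▸ h2)

theorem borelReducible [Countable A] [Countable G] {ι : A →* G} (hι : Function.Injective ι)
    (hC : IsCosetCone ι.range C)
    (hself : ∀ g, (∀ h ∈ ι.range, g⁻¹ * h * g ∈ ι.range) → g ∈ ι.range) :
    BorelReducible (Elo A) (Elo G) := by
  refine ⟨hC.extend hι, (hC.continuous_extend hι).measurable, fun P Q => ?_⟩
  rw [Elo_iff, Elo_iff]
  constructor
  · rintro ⟨a, ha⟩
    refine ⟨ι a, ?_⟩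
    ext x
    rw [mem_image_conj]
    by_cases hx : x ∈ ι.range
    · obtain ⟨b, rfl⟩ := hx
      rw [← map_inv, ← map_mul, ← map_mul, apply_mem_cone_extend, apply_mem_cone_extend, ha, mem_image_conj]
    · have hx' : (ι a)⁻¹ * x * ι a ∉ ι.range := by
        have ha : ι a ∈ ι.range := ⟨a, rfl⟩
        rwa [Subgroup.mul_mem_cancel_right _ ha, Subgroup.mul_mem_cancel_left _ (inv_mem ha)]
      rw [mem_cone_extend_of_notMem _ _ _ hx, mem_cone_extend_of_notMem _ _ _ hx',
        hC.conj_mem ⟨a, rfl⟩]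
  · rintro ⟨g, hg⟩
    have hmem : ∀ x, x ∈ (hC.extend hι Q).cone ↔ g⁻¹ * x * g ∈ (hC.extend hι P).cone :=
      fun x => by rw [hg, mem_image_conj]
    -- The range of `ι` and its conjugate are convex for the order extending `Q`, so one contains
    -- the other; `hself` then applies to `g` or to `g⁻¹`.
    obtain ⟨a, rfl⟩ : g ∈ ι.range := by
      rcases hC.conj_le_or_le_conj (hC.extend hι Q).isPositiveCone Set.subset_union_right
        (fun x hx => (hmem x).2 (Or.inr hx)) with h | h
      · exact hself g h
      · exact inv_mem_iff.1 (hself g⁻¹ (by simpa using h))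
    refine ⟨a, Set.ext fun b => ?_⟩
    rw [mem_image_conj, ← apply_mem_cone_extend hι hC, ← apply_mem_cone_extend hι hC, hmem, map_mul,
      map_mul, map_inv]

end IsCosetCone

/-! ### Actions of free groups on the line -/

/-- A partial map of the line whose slopes lie between `1/3` and `3` extends to an order
automorphism. -/
theorem exists_orderIso_extending (Γ : Set (ℝ × ℝ))
    (hΓ : ∀ p ∈ Γ, ∀ q ∈ Γ, p.1 ≤ q.1 →
      q.1 - p.1 ≤ 3 * (q.2 - p.2) ∧ q.2 - p.2 ≤ 3 * (q.1 - p.1)) :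
    ∃ φ : ℝ ≃o ℝ, ∀ p ∈ Γ, φ p.1 = p.2 := by
  have hfun : ∀ x ∈ Prod.fst '' Γ, ∃ y, (x, y) ∈ Γ := by
    rintro _ ⟨⟨x, y⟩, h, rfl⟩
    exact ⟨y, h⟩
  choose! f hf using hfun
  have hval : ∀ p ∈ Γ, f p.1 = p.2 := by
    intro p hp
    have h := hΓ _ (hf _ ⟨p, hp, rfl⟩) _ hp le_rfl
    simp only at h
    linarith [h.1, h.2]
  -- The slope interval `[1/3, 3]` is `5/3 ± 4/3`: subtracting the mean slope leaves a Lipschitz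
  -- function, which extends to the whole line. Adding the mean slope back keeps slopes at least
  -- `1/3`.
  have hlip : LipschitzOnWith (4 / 3) (fun x => f x - 5 / 3 * x) (Prod.fst '' Γ) := by
    refine LipschitzOnWith.of_dist_le_mul fun x hx y hy => ?_
    rw [Real.dist_eq, Real.dist_eq]
    push_cast
    rcases le_total x y with h | h
    · have := hΓ _ (hf _ hx) _ (hf _ hy) h
      simp only at this
      rw [abs_of_nonpos (sub_nonpos.2 h), abs_le]
      constructor <;> linarith [this.1, this.2]
    · have := hΓ _ (hf _ hy) _ (hf _ hx) h
      simp only at this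
      rw [abs_of_nonneg (sub_nonneg.2 h), abs_le]
      constructor <;> linarith [this.1, this.2]
  obtain ⟨g, hg, hfg⟩ := hlip.extend_real
  have hb : ∀ x y, x ≤ y → |g y - g x| ≤ 4 / 3 * (y - x) := by
    intro x y h
    have := hg.dist_le_mul y x
    rw [Real.dist_eq, Real.dist_eq, abs_of_nonneg (sub_nonneg.2 h)] at this
    simpa using this
  have hlow : ∀ x y, x ≤ y → (y - x) / 3 ≤ (g y + 5 / 3 * y) - (g x + 5 / 3 * x) := by
    intro x y h
    linarith [(abs_le.1 (hb x y h)).1]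
  have hmono : StrictMono fun x => g x + 5 / 3 * x := by
    intro x y h
    linarith [hlow x y h.le]
  have hsurj : Function.Surjective fun x => g x + 5 / 3 * x := by
    refine Continuous.surjective (by have := hg.continuous; fun_prop) ?_ ?_
    · refine Filter.tendsto_atTop_mono' _ ?_
        (Filter.tendsto_atTop_add_const_right _ (g 0)
          (Filter.tendsto_id.atTop_div_const (by norm_num : (0 : ℝ) < 3)))
      filter_upwards [Filter.eventually_ge_atTop 0] with x hx
      have := hlow 0 x hx
      simp only [id]
      linarith
    · refine Filter.tendsto_atBot_mono' _ ?_
        (Filter.tendsto_atBot_add_const_right _ (g 0)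
          (Filter.tendsto_id.atBot_div_const (by norm_num : (0 : ℝ) < 3)))
      filter_upwards [Filter.eventually_le_atBot 0] with x hx
      have := hlow x 0 hx
      simp only [id]
      linarith
  refine ⟨hmono.orderIsoOfSurjective _ hsurj, fun p hp => ?_⟩
  have := hfg ⟨p, hp, rfl⟩
  simp only at this
  simp only [StrictMono.coe_orderIsoOfSurjective]
  rw [← this, hval p hp]
  ring

/-- The integer points that a generator is prescribed to move, along the word `M`; generators
satisfying `S` are moreover to fix `0`. -/
def wordStep {α : Type*} (S : α → Prop) (M : List (α × Bool)) (i : α) : Set (ℕ × ℕ) :=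
  {p | (M[p.1]? = some (i, true) ∧ p.2 = p.1 + 1) ∨ (M[p.2]? = some (i, false) ∧ p.1 = p.2 + 1) ∨
    (S i ∧ p.1 = 0 ∧ p.2 = 0)}

/-- Two moves in the same direction give slope `1`. For opposite moves, reducedness keeps the two
letters at least two places apart; the extreme pairs `(n, n+1)`, `(n+3, n+2)` and `(n+1, n)`, `(n+2,
n+3)` give slopes `1/3` and `3`. By `h0`, a generator required to fix `0` is never the first letter,
so its moves avoid `0`. -/
theorem wordStep_slope {α : Type*} {S : α → Prop} {M : List (α × Bool)}
    (hM : FreeGroup.IsReduced M) (h0 : ∀ a, M[0]? = some a → ¬ S a.1) {i : α} {p q : ℕ × ℕ}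
    (hp : p ∈ wordStep S M i) (hq : q ∈ wordStep S M i) (hpq : p.1 ≤ q.1) :
    q.1 + 3 * p.2 ≤ 3 * q.2 + p.1 ∧ q.2 + 3 * p.1 ≤ 3 * q.1 + p.2 := by
  obtain ⟨x, y⟩ := p
  obtain ⟨x', y'⟩ := q
  have adj : ∀ n b c, M[n]? = some (i, b) → M[n + 1]? = some (i, c) → b = c := by
    intro n b c h1 h2
    obtain ⟨hn, h2⟩ := List.getElem?_eq_some_iff.1 h2
    obtain ⟨_, h1⟩ := List.getElem?_eq_some_iff.1 h1
    have := List.isChain_iff_getElem.1 hM n hn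
    rw [h1, h2] at this
    exact this rfl
  have opp : ∀ n m, M[n]? = some (i, true) → M[m]? = some (i, false) →
      n ≠ m ∧ n ≠ m + 1 ∧ m ≠ n + 1 := by
    intro n m h1 h2
    refine ⟨?_, ?_, ?_⟩ <;> rintro rfl
    · simp [h1] at h2
    · simpa using adj _ _ _ h2 h1
    · simpa using adj _ _ _ h1 h2
  have start : ∀ n b, S i → M[n]? = some (i, b) → n ≠ 0 := by
    rintro _ b hS h rfl
    exact h0 _ h hS
  simp only at hpq ⊢
  rcases hp with ⟨h1, e1⟩ | ⟨h1, e1⟩ | ⟨h1, e1, e1'⟩ <;>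
    rcases hq with ⟨h2, e2⟩ | ⟨h2, e2⟩ | ⟨h2, e2, e2'⟩ <;>
    simp only at h1 h2 e1 e2
  · omega
  · have := opp _ _ h1 h2
    omega
  · simp only at e2'
    have := start _ _ h2 h1
    omega
  · have := opp _ _ h2 h1
    omega
  · omega
  · simp only at e2'
    omega
  · simp only at e1'
    have := start _ _ h1 h2
    omega
  · simp only at e1'
    have := start _ _ h1 h2
    omega
  · simp only at e1' e2'
    omega

/-- The letters push `0` along `0, 1, 2, …`, one unit each. The word is reversed because the
rightmost letter of a product acts first. -/
theorem FreeGroup.exists_action_of_word {α : Type*} (S : α → Prop) {M : List (α × Bool)}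
    (hM : FreeGroup.IsReduced M) (h0 : ∀ a, M[0]? = some a → ¬ S a.1) :
    ∃ φ : α → (ℝ ≃o ℝ), (∀ i, S i → φ i 0 = 0) ∧
      FreeGroup.lift φ (FreeGroup.mk M.reverse) 0 = M.length := by
  have hext : ∀ i, ∃ φ : ℝ ≃o ℝ, ∀ p ∈ wordStep S M i, φ p.1 = p.2 := by
    intro i
    obtain ⟨φ, hφ⟩ := exists_orderIso_extending
      ((fun p : ℕ × ℕ => ((p.1 : ℝ), (p.2 : ℝ))) '' wordStep S M i) (by
        rintro _ ⟨p, hp, rfl⟩ _ ⟨q, hq, rfl⟩ hpq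
        have h := wordStep_slope hM h0 hp hq (by simpa using hpq)
        have h1 : (q.1 : ℝ) + 3 * p.2 ≤ 3 * q.2 + p.1 := by exact_mod_cast h.1
        have h2 : (q.2 : ℝ) + 3 * p.1 ≤ 3 * q.1 + p.2 := by exact_mod_cast h.2
        constructor <;> simp only <;> linarith)
    exact ⟨φ, fun p hp => hφ _ ⟨p, hp, rfl⟩⟩
  choose φ hφ using hext
  refine ⟨φ, fun i hi => by simpa using hφ i (0, 0) (Or.inr (Or.inr ⟨hi, rfl, rfl⟩)), ?_⟩
  have hlet : ∀ (n : ℕ) a, M[n]? = some a →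
      FreeGroup.lift φ (FreeGroup.mk [a]) (n : ℝ) = ((n + 1 : ℕ) : ℝ) := by
    rintro n ⟨i, b⟩ h
    cases b
    · have := hφ i (n + 1, n) (Or.inr (Or.inl ⟨h, rfl⟩))
      simp only at this
      rw [← this]
      simp [FreeGroup.lift_mk]
    · simpa [FreeGroup.lift_mk] using hφ i (n, n + 1) (Or.inl ⟨h, rfl⟩)
  clear hφ hM h0
  induction M using List.reverseRecOn with
  | nil => simp [← FreeGroup.one_eq_mk]
  | append_singleton N a ih =>
    have ih := ih fun n b h => hlet n b (by
      rw [List.getElem?_append_left (List.getElem?_eq_some_iff.1 h).1, h])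
    rw [List.reverse_append, ← FreeGroup.mul_mk, _root_.map_mul, RelIso.mul_apply, ih]
    have := hlet N.length a (by simp)
    simpa using this

/-- The split is at the last letter outside `S`: the tail fixes `0`, so the orbit of `0` is decided
by `L₁ ++ [t]`, whose first acting letter `t` is free to move `0`. -/
theorem FreeGroup.mk_mem_closure_or_split {α : Type*} (S : Set α) (L : List (α × Bool)) :
    FreeGroup.mk L ∈ Subgroup.closure (FreeGroup.of '' S) ∨
      ∃ L₁ t L₂, L = L₁ ++ t :: L₂ ∧ t.1 ∉ S ∧
        FreeGroup.mk L₂ ∈ Subgroup.closure (FreeGroup.of '' S) := by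
  induction L with
  | nil => exact Or.inl (one_mem _)
  | cons a L ih =>
    rcases ih with h | ⟨L₁, t, L₂, rfl, ht, h⟩
    · by_cases ha : a.1 ∈ S
      · left
        have hof : FreeGroup.of a.1 ∈ Subgroup.closure (FreeGroup.of '' S) :=
          Subgroup.subset_closure ⟨a.1, ha, rfl⟩
        have : FreeGroup.mk (a :: L) = FreeGroup.mk [a] * FreeGroup.mk L := by
          rw [FreeGroup.mul_mk]; rfl
        rw [this]
        refine mul_mem ?_ h
        obtain ⟨i, b⟩ := a
        cases b
        · exact inv_mem hof
        · exact hof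
      · exact Or.inr ⟨[], a, L, rfl, ha, h⟩
    · exact Or.inr ⟨a :: L₁, t, L₂, rfl, ht, h⟩

/-- Off the subgroup generated by part of the basis, an element of a free group moves `0` in some
order-preserving action on the line in which that subgroup fixes `0`. -/
theorem FreeGroup.exists_action {α : Type*} (S : Set α) {k : FreeGroup α}
    (hk : k ∉ Subgroup.closure (FreeGroup.of '' S)) :
    ∃ ρ : FreeGroup α →* (ℝ ≃o ℝ),
      (∀ h ∈ Subgroup.closure (FreeGroup.of '' S), ρ h 0 = 0) ∧ ρ k 0 ≠ 0 := by
  classical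
  rcases FreeGroup.mk_mem_closure_or_split S k.toWord with h | ⟨L₁, t, L₂, hL, ht, h⟩
  · rw [FreeGroup.mk_toWord] at h
    exact absurd h hk
  have hred : FreeGroup.IsReduced (L₁ ++ [t]) :=
    (FreeGroup.isReduced_toWord (x := k)).infix ⟨[], L₂, by simp [hL]⟩
  have hrev : FreeGroup.IsReduced (L₁ ++ [t]).reverse := by
    unfold FreeGroup.IsReduced at hred ⊢
    rw [List.isChain_reverse]
    exact hred.imp fun a b h e => (h e.symm).symm
  obtain ⟨φ, hφ, hlen⟩ := FreeGroup.exists_action_of_word (· ∈ S) hrev (by simpa using ht)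
  have hfix : ∀ h ∈ Subgroup.closure (FreeGroup.of '' S), FreeGroup.lift φ h 0 = 0 := by
    intro h hh
    induction hh using Subgroup.closure_induction with
    | mem x hx =>
      obtain ⟨i, hi, rfl⟩ := hx
      simpa using hφ i hi
    | one => simp
    | mul x y _ _ hx hy => rw [_root_.map_mul, RelIso.mul_apply, hy, hx]
    | inv x _ hx =>
      rw [_root_.map_inv]
      nth_rewrite 1 [← hx]
      exact RelIso.inv_apply_self _ _
  refine ⟨FreeGroup.lift φ, hfix, ?_⟩
  have hk' : k = FreeGroup.mk (L₁ ++ [t]) * FreeGroup.mk L₂ := by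
    rw [FreeGroup.mul_mk, List.append_assoc, List.singleton_append, ← hL, FreeGroup.mk_toWord]
  rw [List.reverse_reverse] at hlen
  rw [hk', _root_.map_mul, RelIso.mul_apply, hfix _ h, hlen]
  simp
  positivity

/-! ### Construction of coset orders -/

/-- Actions on the line combine lexicographically to an order on the cosets of a common
stabilizer. -/
theorem IsCosetCone.exists_of_actions {G : Type*} [Group G] [Countable G] {H : Subgroup G}
    (hact : ∀ k ∉ H, ∃ ρ : G →* (ℝ ≃o ℝ), (∀ h ∈ H, ρ h 0 = 0) ∧ ρ k 0 ≠ 0) :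
    ∃ C, IsCosetCone H C := by
  have hact' : ∀ k, ∃ ρ : G →* (ℝ ≃o ℝ), (∀ h ∈ H, ρ h 0 = 0) ∧ (k ∉ H → ρ k 0 ≠ 0) := by
    intro k
    by_cases hk : k ∈ H
    · exact ⟨1, by simp, fun h => absurd hk h⟩
    · obtain ⟨ρ, h1, h2⟩ := hact k hk
      exact ⟨ρ, h1, fun _ => h2⟩
  choose σ hσ hσ' using hact'
  obtain ⟨e, he⟩ := exists_surjective_nat G
  set ρ : ℕ → G →* (ℝ ≃o ℝ) := fun n => σ (e n)
  have hfix : ∀ n, ∀ h ∈ H, ρ n h 0 = 0 := fun n => hσ (e n)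
  have hsep : ∀ k ∉ H, ∃ n, ρ n k 0 ≠ 0 := fun k hk => by
    obtain ⟨n, rfl⟩ := he k
    exact ⟨n, hσ' _ hk⟩
  have hmul : ∀ n x y, ρ n (x * y) 0 = ρ n x (ρ n y 0) := fun n x y => by
    rw [map_mul, RelIso.mul_apply]
  have hpos : ∀ n x {r : ℝ}, 0 < r → ρ n x 0 < ρ n x r := fun n x r h => (ρ n x).strictMono h
  -- An element is positive when the first action in which it moves `0` moves it to the right.
  refine ⟨{g | ∃ n, (∀ m < n, ρ m g 0 = 0) ∧ 0 < ρ n g 0}, ?_, ?_, ?_, ?_, ?_⟩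
  · rintro x y ⟨n, hn, hn'⟩ ⟨m, hm, hm'⟩
    rcases lt_or_ge n m with h | h
    · exact ⟨n, fun l hl => by rw [hmul, hm l (hl.trans h), hn l hl], by rwa [hmul, hm n h]⟩
    · refine ⟨m, fun l hl => by rw [hmul, hm l hl, hn l (hl.trans_le h)], ?_⟩
      rw [hmul]
      refine lt_of_le_of_lt ?_ (hpos m x hm')
      rcases h.lt_or_eq with h | rfl
      · exact (hn m h).ge
      · exact hn'.le
  · rintro h x hh ⟨n, hn, hn'⟩
    refine ⟨n, fun l hl => by rw [hmul, hn l hl, hfix l h hh], ?_⟩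
    have := hpos n h hn'
    rwa [hfix n h hh, ← hmul] at this
  · rintro x h ⟨n, hn, hn'⟩ hh
    exact ⟨n, fun l hl => by rw [hmul, hfix l h hh, hn l hl], by rwa [hmul, hfix n h hh]⟩
  · rintro x ⟨n, -, hn⟩ hx
    exact hn.ne' (hfix n x hx)
  · intro x
    by_cases hx : x ∈ H
    · exact Or.inl hx
    right
    classical
    have hex := hsep x hx
    have hinv : ∀ n, ρ n x⁻¹ (ρ n x 0) = 0 := fun n => by
      rw [← hmul]; simp
    have hmin : ∀ m < Nat.find hex, ρ m x 0 = 0 := fun m hm => by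
      simpa using Nat.find_min hex hm
    rcases (Nat.find_spec hex).lt_or_gt with h | h
    · refine Or.inr ⟨Nat.find hex, fun m hm => ?_, ?_⟩
      · have := hinv m
        rwa [hmin m hm] at this
      · have := (ρ (Nat.find hex) x⁻¹).strictMono h
        rwa [hinv] at this
    · exact Or.inl ⟨Nat.find hex, hmin, h⟩

/-- The `Q` coordinate decides first and `C` breaks ties. The action `φ` need not preserve `C`: `C`
is consulted only when the `Q` coordinates are trivial, and then `φ` does not twist. -/
theorem IsCosetCone.semidirectProduct {N Q : Type*} [Group N] [CommGroup Q] [LinearOrder Q]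
    [IsOrderedMonoid Q] (φ : Q →* MulAut N) {H : Subgroup N} {C : Set N} (hC : IsCosetCone H C) :
    IsCosetCone (H.map (SemidirectProduct.inl : N →* N ⋊[φ] Q))
      {g | 1 < g.right ∨ g.right = 1 ∧ g.left ∈ C} where
  mul_mem := by
    rintro x y (hx | ⟨hx, hx'⟩) (hy | ⟨hy, hy'⟩)
    · exact Or.inl (one_lt_mul'' hx hy)
    · exact Or.inl (by simpa [hy])
    · exact Or.inl (by simpa [hx])
    · exact Or.inr ⟨by simp [hx, hy], by simpa [hx] using hC.mul_mem hx' hy'⟩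
  subgroup_mul_mem := by
    rintro _ x ⟨h, hh, rfl⟩ (hx | ⟨hx, hx'⟩)
    · exact Or.inl (by simpa)
    · exact Or.inr ⟨by simp [hx], by simpa using hC.subgroup_mul_mem hh hx'⟩
  mul_subgroup_mem := by
    rintro x _ (hx | ⟨hx, hx'⟩) ⟨h, hh, rfl⟩
    · exact Or.inl (by simpa)
    · exact Or.inr ⟨by simp [hx], by simpa [hx] using hC.mul_subgroup_mem hx' hh⟩
  notMem_subgroup := by
    rintro _ hx ⟨h, hh, rfl⟩
    rcases hx with hx | ⟨-, hx⟩
    · simp at hx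
    · exact hC.notMem_subgroup hx hh
  trichotomy x := by
    rcases lt_trichotomy x.right 1 with h | h | h
    · exact Or.inr (Or.inr (Or.inl (by simpa)))
    · rcases hC.trichotomy x.left with hx | hx | hx
      · exact Or.inl ⟨x.left, hx, by ext <;> simp [h]⟩
      · exact Or.inr (Or.inl (Or.inr ⟨h, hx⟩))
      · exact Or.inr (Or.inr (Or.inr ⟨by simp [h], by simpa [h] using hx⟩))
    · exact Or.inr (Or.inl (Or.inl h))

/-! ### Self-conjugation of infinite-rank free factors -/

theorem FreeGroup.exists_finset_lift_congr {α : Type*} (k : FreeGroup α) :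
    ∃ F : Finset α, ∀ {Γ : Type _} [Group Γ] (f g : α → Γ), (∀ i ∈ F, f i = g i) →
      FreeGroup.lift f k = FreeGroup.lift g k := by
  classical
  induction k using FreeGroup.induction_on with
  | C1 => exact ⟨∅, fun f g _ => by simp⟩
  | of i => exact ⟨{i}, fun f g h => by simpa using h⟩
  | inv_of i ih =>
    obtain ⟨F, hF⟩ := ih
    exact ⟨F, fun f g h => by rw [_root_.map_inv, _root_.map_inv, hF f g h]⟩
  | mul x y hx hy =>
    obtain ⟨F, hF⟩ := hx
    obtain ⟨F', hF'⟩ := hy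
    refine ⟨F ∪ F', fun f g h => ?_⟩
    rw [_root_.map_mul, _root_.map_mul, hF f g fun i hi => h i (Finset.mem_union_left _ hi),
      hF' f g fun i hi => h i (Finset.mem_union_right _ hi)]

/-- Some `s ∈ S` does not occur in `z`, so in the regular permutation action the image of `s` can be
changed without affecting that of `z`. Letting `s` act as a transposition of `z` with a new point
`w` destroys commutation: at `1`, one product gives `z`, the other `w`. -/
theorem FreeGroup.eq_one_of_commute_of_infinite {α : Type*} {S : Set α} (hS : S.Infinite)
    {z : FreeGroup α} (hz : ∀ s ∈ S, Commute z (FreeGroup.of s)) : z = 1 := by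
  classical
  by_contra hne
  obtain ⟨F, hF⟩ := FreeGroup.exists_finset_lift_congr z
  obtain ⟨s, hs, hsF⟩ := hS.exists_notMem_finset F
  have : Nonempty α := ⟨s⟩
  let f : α → Equiv.Perm (FreeGroup α) := fun i => MulAction.toPerm (FreeGroup.of i)
  have hf : FreeGroup.lift f = MulAction.toPermHom (FreeGroup α) (FreeGroup α) := by
    ext i : 1
    simp [f]
  obtain ⟨w, hw⟩ := Infinite.exists_notMem_finset ({1, z} : Finset (FreeGroup α))
  simp only [Finset.mem_insert, Finset.mem_singleton, not_or] at hw
  have hcomm := (hz s hs).map (FreeGroup.lift (Function.update f s (Equiv.swap z w)))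
  have hupd : FreeGroup.lift (Function.update f s (Equiv.swap z w)) z =
      MulAction.toPermHom (FreeGroup α) (FreeGroup α) z := by
    rw [← hf]
    refine hF _ _ fun i hi => Function.update_of_ne ?_ _ _
    rintro rfl
    exact hsF hi
  rw [hupd, FreeGroup.lift_apply_of, Function.update_self] at hcomm
  have := congrArg (fun p : Equiv.Perm (FreeGroup α) => p 1) hcomm.eq
  simp only [Equiv.Perm.mul_apply, MulAction.toPermHom_apply, MulAction.toPerm_apply, smul_eq_mul,
    mul_one, Equiv.swap_apply_left] at this
  rw [Equiv.swap_apply_of_ne_of_ne (Ne.symm hne) (Ne.symm hw.1), mul_one] at this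
  exact hw.2 this.symm

/-- An element conjugating an infinite-rank free factor into itself lies in it. -/
theorem FreeGroup.mem_closure_of_conj_mem {α : Type*} {S : Set α} (hS : S.Infinite)
    {k : FreeGroup α}
    (hk : ∀ s ∈ S, k⁻¹ * FreeGroup.of s * k ∈ Subgroup.closure (FreeGroup.of '' S)) :
    k ∈ Subgroup.closure (FreeGroup.of '' S) := by
  classical
  let r : FreeGroup α →* FreeGroup α :=
    FreeGroup.lift fun i => if i ∈ S then FreeGroup.of i else 1
  have hr : ∀ h ∈ Subgroup.closure (FreeGroup.of '' S), r h = h := by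
    refine MonoidHom.eqOn_closure (f := r) (g := MonoidHom.id _) ?_
    rintro _ ⟨s, hs, rfl⟩
    simp [r, hs]
  have hmem : ∀ x, r x ∈ Subgroup.closure (FreeGroup.of '' S) := by
    intro x
    refine FreeGroup.range_lift_le (s := Subgroup.closure (FreeGroup.of '' S)) ?_ ⟨x, rfl⟩
    rintro _ ⟨i, rfl⟩
    by_cases hi : i ∈ S
    · simpa [hi] using Subgroup.subset_closure (Set.mem_image_of_mem FreeGroup.of hi)
    · simp [hi]
  -- The retraction `r` fixes both `s` and `k⁻¹ * s * k`, so `r k` conjugates `s` exactly as `k`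
  -- does.
  have hz : k * (r k)⁻¹ = 1 := by
    refine FreeGroup.eq_one_of_commute_of_infinite hS fun s hs => ?_
    have h := hr _ (hk s hs)
    rw [_root_.map_mul, _root_.map_mul, _root_.map_inv, hr _ (Subgroup.subset_closure ⟨s, hs, rfl⟩)] at h
    calc k * (r k)⁻¹ * FreeGroup.of s = k * ((r k)⁻¹ * FreeGroup.of s * r k) * (r k)⁻¹ := by group
      _ = FreeGroup.of s * (k * (r k)⁻¹) := by rw [h]; group
  rw [mul_inv_eq_one.1 hz]
  exact hmem k

/-! ### The free group on two generators as a semidirect product -/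

/-- The shift action of `ℤ` on the free group with basis `ℤ`. -/
def shiftHom : Multiplicative ℤ →* MulAut (FreeGroup ℤ) where
  toFun n := FreeGroup.freeGroupCongr (Equiv.addRight n.toAdd)
  map_one' := by
    refine MulEquiv.toMonoidHom_injective ?_
    ext i
    simp
  map_mul' m n := by
    refine MulEquiv.toMonoidHom_injective ?_
    ext i
    simp [add_comm, add_left_comm]

theorem shiftHom_of (n : Multiplicative ℤ) (i : ℤ) :
    shiftHom n (FreeGroup.of i) = FreeGroup.of (i + n.toAdd) := by
  simp [shiftHom]

/-- The free group on two generators as the semidirect product of a free group of infinite rank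
by the shift. -/
def freeGroupTwoEquiv : FreeGroup (Fin 2) ≃* FreeGroup ℤ ⋊[shiftHom] Multiplicative ℤ :=
  MonoidHom.toMulEquiv
    (FreeGroup.lift ![SemidirectProduct.inl (FreeGroup.of 0),
      SemidirectProduct.inr (Multiplicative.ofAdd 1)])
    (SemidirectProduct.lift
      (FreeGroup.lift fun i => FreeGroup.of 1 ^ i * FreeGroup.of 0 * (FreeGroup.of 1 ^ i)⁻¹)
      (zpowersHom _ (FreeGroup.of 1))
      (fun n => by
        ext i : 1
        simp only [MonoidHom.comp_apply, MulEquiv.coe_toMonoidHom, shiftHom_of,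
          FreeGroup.lift_apply_of, zpowersHom_apply, MulAut.conj_apply, add_comm i, zpow_add]
        group))
    (by
      ext i : 1
      fin_cases i <;> simp)
    (by
      refine SemidirectProduct.hom_ext ?_ ?_
      · ext i : 1
        have h := SemidirectProduct.inl_aut (φ := shiftHom) (Multiplicative.ofAdd i) (FreeGroup.of 0)
        rw [shiftHom_of, zero_add, toAdd_ofAdd, map_inv] at h
        have hpow : (SemidirectProduct.inr (Multiplicative.ofAdd 1) :
            FreeGroup ℤ ⋊[shiftHom] Multiplicative ℤ) ^ i =
            SemidirectProduct.inr (Multiplicative.ofAdd i) := by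
          rw [← map_zpow, ← ofAdd_zsmul]
          simp
        simp only [MonoidHom.comp_apply, SemidirectProduct.lift_inl, FreeGroup.lift_apply_of,
          map_mul, map_inv, map_zpow, MonoidHom.id_apply, Matrix.cons_val_zero,
          Matrix.cons_val_one, hpow]
        exact h.symm
      · refine MonoidHom.ext_mint ?_
        simp)

theorem semidirectProduct_shiftHom_self_conj {g : FreeGroup ℤ ⋊[shiftHom] Multiplicative ℤ}
    (hg : ∀ h ∈ (Subgroup.closure (FreeGroup.of '' {i : ℤ | i ≠ 0})).map
        (SemidirectProduct.inl : FreeGroup ℤ →* FreeGroup ℤ ⋊[shiftHom] Multiplicative ℤ),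
      g⁻¹ * h * g ∈ (Subgroup.closure (FreeGroup.of '' {i : ℤ | i ≠ 0})).map
        (SemidirectProduct.inl : FreeGroup ℤ →* FreeGroup ℤ ⋊[shiftHom] Multiplicative ℤ)) :
    g ∈ (Subgroup.closure (FreeGroup.of '' {i : ℤ | i ≠ 0})).map
        (SemidirectProduct.inl : FreeGroup ℤ →* FreeGroup ℤ ⋊[shiftHom] Multiplicative ℤ) := by
  obtain ⟨k, n⟩ := g
  have hconj : ∀ i : ℤ, i ≠ 0 → shiftHom n⁻¹ (k⁻¹ * FreeGroup.of i * k) ∈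
      Subgroup.closure (FreeGroup.of '' {i : ℤ | i ≠ 0}) := by
    intro i hi
    obtain ⟨y, hy, e⟩ := hg _ ⟨_, Subgroup.subset_closure ⟨i, hi, rfl⟩, rfl⟩
    have := congrArg SemidirectProduct.left e
    simp at this
    simpa [← this] using hy
  have hn : n = 1 := by
    by_contra hne
    -- The exponent sum of the omitted generator vanishes on the subgroup. If `n` were nontrivial,
    -- the basis element of index `n` would be carried to a conjugate of that generator, with
    -- exponent sum `1`.
    let c : FreeGroup ℤ →* Multiplicative ℤ :=
      FreeGroup.lift fun i => if i = 0 then Multiplicative.ofAdd 1 else 1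
    have hc : ∀ h ∈ Subgroup.closure (FreeGroup.of '' {i : ℤ | i ≠ 0}), c h = 1 := by
      refine MonoidHom.eqOn_closure (f := c) (g := 1) ?_
      rintro _ ⟨i, hi, rfl⟩
      simpa [c] using hi
    have h := hc _ (hconj n.toAdd hne)
    rw [map_mul, map_mul, map_mul, map_mul, map_inv (shiftHom n⁻¹), map_inv c, mul_right_comm,
      inv_mul_cancel, one_mul, shiftHom_of] at h
    simp [c] at h
  subst hn
  refine ⟨k, FreeGroup.mem_closure_of_conj_mem (S := {i : ℤ | i ≠ 0})
    (Set.finite_singleton 0).infinite_compl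
    fun s hs => ?_, rfl⟩
  simpa using hconj s hs

theorem mainTheorem8 :
    BorelReducible (Elo (FreeGroup ℕ)) (Elo (FreeGroup (Fin 2))) := by
  have : Infinite {i : ℤ | i ≠ 0} := (Set.finite_singleton (0 : ℤ)).infinite_compl.to_subtype
  obtain ⟨e⟩ : Nonempty (ℕ ≃ {i : ℤ | i ≠ 0}) := nonempty_equiv_of_countable
  let H := Subgroup.closure (FreeGroup.of '' {i : ℤ | i ≠ 0})
  let κ : FreeGroup ℕ →* FreeGroup ℤ := FreeGroup.map fun n => (e n : ℤ)
  have hκ : κ.range = H := by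
    have : Set.range (fun n => FreeGroup.of (e n : ℤ)) = FreeGroup.of '' {i : ℤ | i ≠ 0} := by
      ext x
      constructor
      · rintro ⟨n, rfl⟩
        exact ⟨e n, (e n).2, rfl⟩
      · rintro ⟨i, hi, rfl⟩
        exact ⟨e.symm ⟨i, hi⟩, by simp⟩
    rw [show H = Subgroup.closure _ from rfl, ← this, ← FreeGroup.range_lift_eq_closure,
      show κ = FreeGroup.lift _ from FreeGroup.map_eq_lift]
    rfl
  have hκinj : Function.Injective κ :=
    FreeGroup.map_injective (Subtype.val_injective.comp e.injective)
  obtain ⟨C, hC⟩ := IsCosetCone.exists_of_actions (H := H) fun k hk =>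
    FreeGroup.exists_action {i : ℤ | i ≠ 0} hk
  let ι : FreeGroup ℕ →* FreeGroup (Fin 2) :=
    freeGroupTwoEquiv.symm.toMonoidHom.comp (SemidirectProduct.inl.comp κ)
  have hι : Function.Injective ι :=
    freeGroupTwoEquiv.symm.injective.comp (SemidirectProduct.inl_injective.comp hκinj)
  have hrange : ι.range = (H.map SemidirectProduct.inl).comap freeGroupTwoEquiv.toMonoidHom := by
    ext x
    rw [← hκ]
    constructor
    · rintro ⟨a, rfl⟩
      exact ⟨κ a, ⟨a, rfl⟩, by simp [ι]⟩
    · rintro ⟨_, ⟨a, rfl⟩, h⟩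
      exact ⟨a, freeGroupTwoEquiv.injective (by simpa [ι] using h)⟩
  have hcone := (hC.semidirectProduct shiftHom).comap freeGroupTwoEquiv.toMonoidHom
  rw [← hrange] at hcone
  refine hcone.borelReducible hι fun g hg => ?_
  rw [hrange] at hg ⊢
  refine semidirectProduct_shiftHom_self_conj fun h hh => ?_
  obtain ⟨x, rfl⟩ := freeGroupTwoEquiv.surjective h
  simpa using hg x hh
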